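/- Let $p$ be a prime and $q\ge 0$ an integer. For $n\ge 0$ let $S_n$ act on $R=\mathbb{F}_p[x_1,\dots,x_n]$ by permuting the variables, so that $R^{S_n}=\mathbb{F}_p[e_1,\dots,e_n]$ with $e_i$ the elementary symmetric polynomials, and let $I_n\subseteq R^{S_n}$ be the ideal which is the image of the transfer map $\mathrm{Tr}\colon R\to R^{S_n}$, $f\mapsto\sum_{g\in S_n} g\cdot f$. Give $R^{S_n}$ the $\mathbb{Z}/p\mathbb{Z}$-grading with $\deg(e_i)=i \bmod p$. Let $A=\mathbb{F}_p[e'_1,\dots,e'_{qp}]$ be the $\mathbb{Z}/p\mathbb{Z}$-graded polynomial ring with $\deg(e'_i)=i\bmod p$, and regard $I_{qp}$ as an ideal of $A$ by identifying $A$ with $R^{S_{qp}}$ via $e'_i\leftrightarrow e_i$. Then for each $0\le r\le p-1$ there is an injective ring homomorphism $\iota_r\colon A\hookrightarrow R^{S_{qp+r}}$, homogeneous (degree-preserving) for the $\mathbb{Z}/p\mathbb{Z}$-gradings, such that (i) $\iota_r$ is flat, and (ii) with $R^{S_{qp+r}}$ regarded as an $A$-algebra via $\iota_r$, the rule $s\otimes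 a\mapsto s\,\iota_r(a)$ defines an isomorphism $R^{S_{qp+r}}\otimes_A I_{qp}\cong I_{qp+r}$ of $R^{S_{qp+r}}$-modules (in particular, of $A$-modules). -/

import Mathlib

open MvPolynomial
open scoped TensorProduct

namespace SymTransfer

/-- The invariant ring `R^{S_n}` of `R = k[x_1, …, x_n]`: the subalgebra of symmetric polynomials. -/
abbrev Inv (k : Type*) [CommRing k] (n : ℕ) : Subalgebra k (MvPolynomial (Fin n) k) :=
  symmetricSubalgebra (Fin n) k

/-- The transfer map `R → R^{S_n}`, `f ↦ ∑_{g ∈ S_n} g • f`, as a map of `R^{S_n}`-modules;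
a permutation `g` acts by `x_i ↦ x_{g i}`. -/
noncomputable def transfer (k : Type*) [CommRing k] (n : ℕ) :
    MvPolynomial (Fin n) k →ₗ[Inv k n] Inv k n where
  toFun f := ⟨∑ g : Equiv.Perm (Fin n), rename g f, by
    intro h
    rw [map_sum]
    simp only [rename_rename]
    exact Fintype.sum_equiv (Equiv.mulLeft h) _ _ (fun g => rfl)⟩
  map_add' f g := by
    apply Subtype.ext
    simp [Finset.sum_add_distrib]
  map_smul' s f := by
    apply Subtype.ext
    have hs : ∀ g : Equiv.Perm (Fin n),
        rename g (s : MvPolynomial (Fin n) k) = (s : MvPolynomial (Fin n) k) :=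
      fun g => s.2 g
    simp [Subalgebra.smul_def, hs, Finset.mul_sum]

/-- `I_n`, the image of the transfer, an ideal of `R^{S_n}`. -/
noncomputable def transferIdeal (k : Type*) [CommRing k] (n : ℕ) : Ideal (Inv k n) :=
  LinearMap.range (transfer k n)

/-- The presentation of `R^{S_n}` as the polynomial ring `k[e_1, …, e_n]`: the `i`-th variable
(with `i` counted from `0`) goes to the elementary symmetric polynomial `e_{i+1}`. -/
noncomputable def elemEquiv (k : Type*) [CommRing k] (n : ℕ) :
    MvPolynomial (Fin n) k ≃ₐ[k] Inv k n :=
  esymmAlgEquiv (Fin n) k (Fintype.card_fin n)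

theorem elemEquiv_X (k : Type*) [CommRing k] (n : ℕ) (i : Fin n) :
    (elemEquiv k n (X i) : MvPolynomial (Fin n) k) = esymm (Fin n) k (i + 1) := by
  simp [elemEquiv, esymmAlgEquiv, esymmAlgHom]

/-- The degree-`d` part of the `ℤ/p`-grading of the polynomial ring `𝔽_p[e_1, …, e_m]`
in which `deg e_i = i mod p` (the variable of index `i : Fin m` is `e_{i+1}`). -/
noncomputable def polyDegree (p m : ℕ) (d : ZMod p) :
    Submodule (ZMod p) (MvPolynomial (Fin m) (ZMod p)) :=
  weightedHomogeneousSubmodule (ZMod p) (fun i : Fin m => ((i + 1 : ℕ) : ZMod p)) d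

/-- The degree-`d` part of the `ℤ/p`-grading of `R^{S_n} = 𝔽_p[e_1, …, e_n]` in which
`deg e_i = i mod p`. -/
noncomputable def invDegree (p n : ℕ) (d : ZMod p) : Submodule (ZMod p) (Inv (ZMod p) n) :=
  (polyDegree p n d).map (elemEquiv (ZMod p) n).toLinearMap

/-- `A = 𝔽_p[e'_1, …, e'_{qp}]`; the variable of index `i : Fin (q * p)` is `e'_{i+1}`. -/
abbrev A (p q : ℕ) : Type := MvPolynomial (Fin (q * p)) (ZMod p)

/-- `I_{qp}` as an ideal of `A`, under the identification `e'_i ↔ e_i` of `A` with `R^{S_{qp}}`. -/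
noncomputable def baseIdeal (p q : ℕ) : Ideal (A p q) :=
  (transferIdeal (ZMod p) (q * p)).comap (elemEquiv (ZMod p) (q * p))

/-- With `B` an `A`-algebra via the ring homomorphism `ι : A → B`, the rule `s ⊗ a ↦ s * ι a`
is a well-defined isomorphism `B ⊗_A I ≅ J` of `B`-modules, for ideals `I` of `A` and `J` of `B`. -/
def TensorIso {A B : Type*} [CommRing A] [CommRing B] (ι : A →+* B) (I : Ideal A) (J : Ideal B) :
    Prop :=
  letI : Algebra A B := ι.toAlgebra
  ∃ e : (B ⊗[A] I) ≃ₗ[B] J, ∀ (s : B) (a : I), (e (s ⊗ₜ[A] a) : B) = s * ι (a : A)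

end SymTransfer

/-! In characteristic `p` the ideal `I_n`, for `n = m + p`, consists of the symmetric polynomials
vanishing on the diagonal where `p` variables coincide (`mem_transferIdeal_iff`). A `p`-cycle in the
coinciding variables makes every transfer vanish there. Conversely, vanishing there forces every
exponent to have all fibres of size less than `p`, so its stabilizer has order prime to `p` and its
orbit sum is a multiple of a transfer.

If the common value is `y` and `t = y ^ p`, restriction to the diagonal sends `e_i` to `e_i + t *
e_{i-p}`, because `(T + y) ^ p = T ^ p + y ^ p`. Hence `I_n` is the kernel of `diagHom`. For a
residue `b` modulo `p`, put `E_b(T) = ∑_j e_{b+jp} T^j`; then `diagHom` multiplies each `E_b` by `1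
+ t T`.

For `n = qp + r` and `1 ≤ b ≤ r`, `E_b` has one term more than it has for `n = qp`. Its constant
term `e_b` is fixed by `diagHom`, so `(E_b - e_b E_0) / T` has the right length and is again
multiplied by `1 + t T`. Sending the series `E'_b` of `A` to it, and to `E_b` for the other
residues, defines `embed`. The invariant ring becomes a polynomial ring over `A` in `e_1, …, e_r`
(`assembleEquiv`), which gives injectivity and flatness. Moreover `diagHom` for `qp + r` becomes the
coefficientwise extension of `diagHom` for `qp` (`diagHom_assemble`), so its kernel is generated by
`I_{qp}`. Flatness turns this equality of ideals into the tensor product isomorphism. -/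

namespace SymTransfer

/-! ### Counting modulo `p` with a permutation of order dividing `p`. -/

/-- In characteristic `p`, only the fixed points of a permutation `c` with `c ^ p = 1` contribute
to the sum of a `c`-invariant function. -/
theorem sum_eq_sum_fixed_of_perm_pow_eq_one {p : ℕ} [Fact p.Prime] {α M : Type*} [Fintype α]
    [DecidableEq α] [CommRing M] [CharP M p] [DecidableEq M] (c : Equiv.Perm α) (hc : c ^ p = 1)
    (F : α → M) (hF : ∀ x, F (c x) = F x) :
    ∑ x, F x = ∑ x with c x = x, F x := by
  -- Each level set of `F` is stable under `c`, and the orbits of `c` in it that are not fixed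
  -- points have length `p`.
  have key : ∀ b : M, ((Finset.univ.filter fun x => F x = b).card : M) =
      (((Finset.univ.filter fun x => c x = x).filter fun x => F x = b).card : M) := by
    intro b
    let c' : Equiv.Perm {x // F x = b} := c.subtypePerm (fun x => by rw [hF])
    have hc' : c' ^ p ^ 1 = 1 := by
      ext x
      simp [c', Equiv.Perm.subtypePerm_pow, hc]
    have h := (Equiv.Perm.card_compl_support_modEq hc').symm
    rw [Fintype.card_subtype, ← CharP.natCast_eq_natCast M p] at h
    rw [h]
    congr 1
    rw [← Finset.card_map (Function.Embedding.subtype fun x => F x = b)]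
    congr 1
    ext x
    simp [c', Equiv.Perm.subtypePerm_apply, and_comm]
  have hfib : ∀ s : Finset α, ∑ x ∈ s, F x =
      ∑ b ∈ Finset.univ.image F, ((s.filter fun x => F x = b).card : M) * b := by
    intro s
    rw [← Finset.sum_fiberwise_of_maps_to (t := Finset.univ.image F) (g := F) (by simp)]
    refine Finset.sum_congr rfl fun b _ => ?_
    rw [Finset.sum_congr rfl (g := fun _ => b) (fun x hx => (Finset.mem_filter.1 hx).2),
      Finset.sum_const, nsmul_eq_mul]
  rw [hfib, hfib]
  exact Finset.sum_congr rfl fun b _ => by rw [key]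

theorem coeff_rename_eq_sum {σ τ R : Type*} [CommSemiring R] [DecidableEq τ] (θ : σ → τ)
    (f : MvPolynomial σ R) (e : τ →₀ ℕ) :
    coeff e (rename θ f) = ∑ d ∈ f.support with d.mapDomain θ = e, coeff d f := by
  classical
  conv_lhs => rw [f.as_sum]
  rw [map_sum, coeff_sum, Finset.sum_filter]
  refine Finset.sum_congr rfl fun d _ => ?_
  rw [rename_monomial, coeff_monomial]

theorem mapDomain_apply_eq_sum {σ τ : Type*} [Fintype σ] [DecidableEq τ] (θ : σ → τ) (d : σ →₀ ℕ)
    (t : τ) : d.mapDomain θ t = ∑ x, if θ x = t then d x else 0 := by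
  rw [Finsupp.mapDomain, Finsupp.sum_fintype _ _ (by simp), Finsupp.finsetSum_apply]
  simp [Finsupp.single_apply]

/-! ### The transfer ideal as the ideal of a diagonal. -/

/-- The identification of the last `p` of `m + p` indices with each other. -/
def collapse (m p : ℕ) : Fin (m + p) → Option (Fin m) :=
  Fin.addCases some fun _ => none

@[simp] theorem collapse_castAdd (m p : ℕ) (i : Fin m) :
    collapse m p (Fin.castAdd p i) = some i := by
  simp [collapse]

@[simp] theorem collapse_natAdd (m p : ℕ) (i : Fin p) :
    collapse m p (Fin.natAdd m i) = none := by
  simp [collapse]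

/-- The cyclic permutation of the last `p` of `m + p` indices. -/
def rotateLast (m p : ℕ) [NeZero p] : Equiv.Perm (Fin (m + p)) :=
  finSumFinEquiv.permCongr (Equiv.sumCongr (Equiv.refl _) (Equiv.addRight 1))

@[simp] theorem rotateLast_castAdd (m p : ℕ) [NeZero p] (i : Fin m) :
    rotateLast m p (Fin.castAdd p i) = Fin.castAdd p i := by
  simp [rotateLast, Equiv.permCongr_apply]

@[simp] theorem rotateLast_natAdd (m p : ℕ) [NeZero p] (i : Fin p) :
    rotateLast m p (Fin.natAdd m i) = Fin.natAdd m (i + 1) := by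
  simp [rotateLast, Equiv.permCongr_apply]

theorem rotateLast_pow (m p : ℕ) [NeZero p] : rotateLast m p ^ p = 1 := by
  have h1 : ∀ (j : ℕ) (i : Fin m), (rotateLast m p ^ j) (Fin.castAdd p i) = Fin.castAdd p i := by
    intro j i
    induction j with
    | zero => rfl
    | succ j ih => rw [pow_succ', Equiv.Perm.mul_apply, ih, rotateLast_castAdd]
  have h2 : ∀ (j : ℕ) (i : Fin p),
      (rotateLast m p ^ j) (Fin.natAdd m i) = Fin.natAdd m (i + j • 1) := by
    intro j i
    induction j with
    | zero => simp
    | succ j ih =>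
      rw [pow_succ', Equiv.Perm.mul_apply, ih, rotateLast_natAdd, add_assoc, succ_nsmul]
  ext x
  congr 1
  refine Fin.addCases (fun i => ?_) (fun i => ?_) x
  · rw [h1]; rfl
  · rw [h2]
    have : p • (1 : Fin p) = 0 := by
      simpa using card_nsmul_eq_zero (x := (1 : Fin p))
    rw [this, add_zero]; rfl

theorem collapse_rotateLast (m p : ℕ) [NeZero p] (x : Fin (m + p)) :
    collapse m p (rotateLast m p x) = collapse m p x := by
  refine Fin.addCases (fun i => ?_) (fun i => ?_) x <;> simp

theorem coeff_mapDomain_perm {σ R : Type*} [CommSemiring R] {f : MvPolynomial σ R}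
    (hf : f.IsSymmetric) (w : Equiv.Perm σ) (d : σ →₀ ℕ) :
    coeff (d.mapDomain w) f = coeff d f := by
  conv_lhs => rw [← hf w]
  exact coeff_rename_mapDomain w w.injective f d

/-- The transfer vanishes on the diagonal where the last `p` variables coincide. -/
theorem rename_collapse_transfer (p m : ℕ) [Fact p.Prime]
    (f : MvPolynomial (Fin (m + p)) (ZMod p)) :
    rename (collapse m p)
      (transfer (ZMod p) (m + p) f : MvPolynomial (Fin (m + p)) (ZMod p)) = 0 := by
  classical
  simp only [transfer, LinearMap.coe_mk, AddHom.coe_mk, map_sum, rename_rename]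
  -- Left multiplication by the `p`-cycle acts freely on the symmetric group, and `collapse` does
  -- not see it, so the fixed-point sum is empty.
  rw [sum_eq_sum_fixed_of_perm_pow_eq_one (p := p) (Equiv.mulLeft (rotateLast m p))]
  · rw [Finset.filter_false_of_mem, Finset.sum_empty]
    intro g _ h
    have h1 : rotateLast m p = 1 := by simpa using h
    have h2 := rotateLast_natAdd m p 0
    rw [h1, Equiv.Perm.one_apply] at h2
    have h3 := Fin.natAdd_injective _ _ h2
    have := (Fact.out : p.Prime).two_le
    rw [zero_add] at h3
    have h4 := congrArg Fin.val h3
    rw [Fin.val_one', Fin.val_zero, Nat.mod_eq_of_lt (by omega)] at h4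
    omega
  · have : ∀ j : ℕ, Equiv.mulLeft (rotateLast m p) ^ j = Equiv.mulLeft (rotateLast m p ^ j) := by
      intro j
      exact Equiv.pow_mulLeft _ _
    rw [this, rotateLast_pow]
    ext; simp
  · intro g
    congr 1
    congr 1
    funext x
    exact collapse_rotateLast m p (g x)

/-- If the last `p` exponents of `d` agree, then the coefficient of `d` can be read off after
identifying the last `p` variables. -/
theorem coeff_rename_collapse (p m : ℕ) [Fact p.Prime] {f : MvPolynomial (Fin (m + p)) (ZMod p)}
    (hf : f.IsSymmetric) (d : Fin (m + p) →₀ ℕ) (k : ℕ) (hd : ∀ i, d (Fin.natAdd m i) = k) :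
    coeff (d.mapDomain (collapse m p)) (rename (collapse m p) f) = coeff d f := by
  classical
  -- These exponents contribute to the collapsed coefficient; the rotation permutes them and
  -- preserves their coefficients.
  set S := f.support.filter fun d' => d'.mapDomain (collapse m p) = d.mapDomain (collapse m p)
    with hS
  have hmem : ∀ d', d' ∈ S ↔ d'.mapDomain (rotateLast m p) ∈ S := by
    intro d'
    rw [hS, Finset.mem_filter, Finset.mem_filter, mem_support_iff, mem_support_iff,
      coeff_mapDomain_perm hf, ← Finsupp.mapDomain_comp]
    have : collapse m p ∘ rotateLast m p = collapse m p := funext (collapse_rotateLast m p)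
    rw [this]
  rw [coeff_rename_eq_sum, ← hS, ← Finset.sum_coe_sort]
  let c₀ : Equiv.Perm (Fin (m + p) →₀ ℕ) :=
    (Finsupp.domCongr (rotateLast m p) : (Fin (m + p) →₀ ℕ) ≃+ _).toEquiv
  have hc₀ : ∀ d', c₀ d' = d'.mapDomain (rotateLast m p) := fun d' => by
    simp [c₀, Finsupp.equivMapDomain_eq_mapDomain]
  have hc₀' : ∀ (j : ℕ) d', (c₀ ^ j) d' = d'.mapDomain ⇑(rotateLast m p ^ j) := by
    intro j d'
    induction j with
    | zero => simp
    | succ j ih =>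
      rw [pow_succ', Equiv.Perm.mul_apply, ih, hc₀, ← Finsupp.mapDomain_comp, pow_succ']
      rfl
  let c : Equiv.Perm S := c₀.subtypePerm (fun x => by rw [hc₀]; exact (hmem x).symm)
  -- A rotation-invariant exponent is constant on the last `p` indices. Its collapsed value at
  -- `none` is `p` times that constant, and comparing with `p * k` over the integers leaves only
  -- `d`.
  have huniq : ∀ x : S, c x = x → (x : Fin (m + p) →₀ ℕ) = d := by
    intro x hx
    have hx2 : (x : Fin (m + p) →₀ ℕ).mapDomain (rotateLast m p) = x := by
      rw [← hc₀]; exact congrArg Subtype.val hx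
    have hx3 := (Finset.mem_filter.1 x.2).2
    have hstep : ∀ i, (x : Fin (m + p) →₀ ℕ) (Fin.natAdd m (i + 1)) =
        (x : Fin (m + p) →₀ ℕ) (Fin.natAdd m i) := by
      intro i
      conv_lhs => rw [← hx2, ← rotateLast_natAdd]
      rw [Finsupp.mapDomain_apply (rotateLast m p).injective]
    have hconst : ∀ (j : ℕ) (hj : j < p), (x : Fin (m + p) →₀ ℕ) (Fin.natAdd m ⟨j, hj⟩) =
        (x : Fin (m + p) →₀ ℕ) (Fin.natAdd m 0) := by
      intro j
      induction j with
      | zero => intro _; rfl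
      | succ j ih =>
        intro hj
        rw [← ih (by omega), ← hstep ⟨j, by omega⟩]
        congr 2
        ext
        rw [Fin.val_add, Fin.val_one', Nat.mod_eq_of_lt (a := 1) (by omega), Nat.mod_eq_of_lt hj]
    have hx4 := fun t => DFunLike.congr_fun hx3 t
    simp only [mapDomain_apply_eq_sum, Fin.sum_univ_add, collapse_castAdd, collapse_natAdd] at hx4
    ext y
    refine Fin.addCases (fun i => ?_) (fun i => ?_) y
    · simpa using hx4 (some i)
    · have h5 := hx4 none
      have hc' : ∀ i : Fin p, (x : Fin (m + p) →₀ ℕ) (Fin.natAdd m i) =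
        (x : Fin (m + p) →₀ ℕ) (Fin.natAdd m 0) := fun i => hconst i i.2
      rw [hc', hd]
      simp only [hc', hd] at h5
      have := (Fact.out : p.Prime).pos
      simpa [this.ne'] using h5
  rw [sum_eq_sum_fixed_of_perm_pow_eq_one (p := p) c]
  · by_cases hdS : d ∈ S
    · rw [Finset.sum_eq_single ⟨d, hdS⟩]
      · intro x hx hne
        exact absurd (Subtype.ext (huniq x (Finset.mem_filter.1 hx).2)) hne
      · intro h
        exfalso
        apply h
        rw [Finset.mem_filter]
        refine ⟨Finset.mem_univ _, Subtype.ext ?_⟩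
        change c₀ d = d
        rw [hc₀]
        ext y
        rw [Finsupp.mapDomain_equiv_apply]
        refine Fin.addCases (fun i => ?_) (fun i => ?_) y
        · rw [(Equiv.symm_apply_eq _).2 (rotateLast_castAdd m p i).symm]
        · have : (rotateLast m p).symm (Fin.natAdd m i) = Fin.natAdd m (i - 1) := by
            rw [Equiv.symm_apply_eq, rotateLast_natAdd, sub_add_cancel]
          rw [this, hd, hd]
    · have h0 : coeff d f = 0 := by
        by_contra h
        exact hdS (Finset.mem_filter.2 ⟨mem_support_iff.2 h, rfl⟩)
      rw [h0]
      refine Finset.sum_eq_zero fun x hx => absurd x.2 ?_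
      rwa [huniq x (Finset.mem_filter.1 hx).2]
  · ext x : 2
    simp [c, Equiv.Perm.subtypePerm_pow, hc₀', rotateLast_pow]
  · intro x
    change coeff (c₀ x) f = _
    rw [hc₀, coeff_mapDomain_perm hf]

theorem exists_perm_natAdd {p m : ℕ} {α : Type*} [DecidableEq α] (d : Fin (m + p) → α) (k : α)
    (h : p ≤ Fintype.card {a // d a = k}) :
    ∃ w : Equiv.Perm (Fin (m + p)), ∀ i, d (w (Fin.natAdd m i)) = k := by
  obtain ⟨g⟩ : Nonempty (Fin p ↪ {a // d a = k}) :=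
    Function.Embedding.nonempty_of_card_le (by simpa using h)
  obtain ⟨w, hw⟩ := Finset.exists_equiv_extend_of_card_eq (α := Fin (m + p)) (β := Fin (m + p))
    (t := Finset.univ) (by simp) (s := Finset.univ.image (Fin.natAdd m))
    (f := Fin.addCases (fun i => Fin.castAdd p i) (fun i => (g i : Fin (m + p)))) (by simp) (by
      intro x hx y hy hxy
      simp only [Finset.coe_image, Finset.coe_univ, Set.image_univ, Set.mem_range] at hx hy
      obtain ⟨i, rfl⟩ := hx
      obtain ⟨j, rfl⟩ := hy
      simp only [Fin.addCases_right] at hxy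
      rw [g.injective (Subtype.ext hxy)])
  refine ⟨w.trans (Equiv.subtypeUnivEquiv (by simp)), fun i => ?_⟩
  have := hw (Fin.natAdd m i) (by simp)
  rw [Fin.addCases_right] at this
  rw [Equiv.trans_apply, Equiv.subtypeUnivEquiv_apply, this]
  exact (g i).2

/-- If a symmetric polynomial vanishes after identifying the last `p` variables, then none of its
exponents takes the same value `p` times. -/
theorem card_fiber_lt_of_rename_collapse (p m : ℕ) [Fact p.Prime]
    {f : MvPolynomial (Fin (m + p)) (ZMod p)} (hf : f.IsSymmetric)
    (h0 : rename (collapse m p) f = 0) {d : Fin (m + p) →₀ ℕ} (hd : d ∈ f.support) (k : ℕ) :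
    Fintype.card {a // d a = k} < p := by
  by_contra! h
  -- By symmetry, `p` indices with equal exponents may be moved to the last `p` places.
  obtain ⟨w, hw⟩ := exists_perm_natAdd d k h
  refine mem_support_iff.1 hd ?_
  rw [← coeff_mapDomain_perm hf w.symm d, ← coeff_rename_collapse p m hf _ k, h0, coeff_zero]
  intro i
  rw [Finsupp.mapDomain_equiv_apply, Equiv.symm_symm, hw]

theorem transfer_apply (k : Type*) [CommRing k] (n : ℕ) (f : MvPolynomial (Fin n) k) :
    (transfer k n f : MvPolynomial (Fin n) k) = ∑ g : Equiv.Perm (Fin n), rename g f := rfl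

theorem coeff_transfer_monomial (k : Type*) [CommRing k] (n : ℕ) (d : Fin n →₀ ℕ) (a : k) :
    coeff d (transfer k n (monomial d a) : MvPolynomial (Fin n) k) =
      (Fintype.card {g : Equiv.Perm (Fin n) // d ∘ g = d} : k) * a := by
  classical
  simp only [transfer_apply, rename_monomial, coeff_sum, coeff_monomial]
  rw [← Finset.sum_filter, Finset.sum_const, nsmul_eq_mul, ← Fintype.card_subtype]
  congr 2
  refine Fintype.card_congr (Equiv.subtypeEquivRight fun g => ?_)
  constructor
  · intro h
    funext x
    conv_lhs => rw [← h]
    exact Finsupp.mapDomain_apply g.injective d x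
  · intro h
    ext x
    rw [Finsupp.mapDomain_equiv_apply]
    have := congrFun h (g.symm x)
    simpa using this.symm

theorem exists_of_mem_support_transfer_monomial (k : Type*) [CommRing k] (n : ℕ)
    (d e : Fin n →₀ ℕ) (a : k)
    (h : e ∈ (transfer k n (monomial d a) : MvPolynomial (Fin n) k).support) :
    ∃ g : Equiv.Perm (Fin n), d.mapDomain g = e := by
  classical
  by_contra! hne
  refine mem_support_iff.1 h ?_
  simp only [transfer_apply, rename_monomial, coeff_sum, coeff_monomial]
  exact Finset.sum_eq_zero fun g _ => if_neg (hne g)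

/-- A symmetric polynomial all of whose exponents have a stabilizer of invertible order is a
transfer. -/
theorem mem_transferIdeal_of_stabilizer (k : Type*) [Field k] (n : ℕ) (f : Inv k n)
    (h : ∀ d ∈ (f : MvPolynomial (Fin n) k).support,
      (Fintype.card {g : Equiv.Perm (Fin n) // d ∘ g = d} : k) ≠ 0) :
    f ∈ transferIdeal k n := by
  classical
  induction hN : (f : MvPolynomial (Fin n) k).support.card using Nat.strong_induction_on
    generalizing f with
  | _ N ih =>
    by_cases hf : (f : MvPolynomial (Fin n) k).support = ∅
    · have : f = 0 := Subtype.ext (support_eq_empty.1 hf)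
      rw [this]; exact zero_mem _
    · obtain ⟨d, hd⟩ := Finset.nonempty_iff_ne_empty.2 hf
      set c : k := ((Fintype.card {g : Equiv.Perm (Fin n) // d ∘ g = d} : ℕ) : k)
      -- The transfer of a monomial counts each exponent in the orbit as often as the stabilizer
      -- order `c`; dividing by `c` cancels the term at `d` without leaving the support of `f`.
      set t : Inv k n := transfer k n (monomial d (c⁻¹ * coeff d (f : MvPolynomial (Fin n) k)))
        with ht
      have htm : t ∈ transferIdeal k n := LinearMap.mem_range_self _ _
      have hsub : ((f - t : Inv k n) : MvPolynomial (Fin n) k).support ⊆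
          (f : MvPolynomial (Fin n) k).support.erase d := by
        intro e he
        rw [Finset.mem_erase]
        constructor
        · rintro rfl
          refine mem_support_iff.1 he ?_
          rw [AddSubgroupClass.coe_sub, coeff_sub, ht, coeff_transfer_monomial,
            mul_inv_cancel_left₀ (h _ hd), sub_self]
        · rw [AddSubgroupClass.coe_sub] at he
          rcases Finset.mem_union.1 (support_sub _ _ _ he) with he | he
          · exact he
          · obtain ⟨g, rfl⟩ := exists_of_mem_support_transfer_monomial _ _ _ _ _ he
            rwa [mem_support_iff, coeff_mapDomain_perm f.2, ← mem_support_iff]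
      have := ih _ (by
        rw [← hN]
        exact (Finset.card_le_card hsub).trans_lt (Finset.card_erase_lt_of_mem hd)) (f - t)
        (fun e he => h e (Finset.mem_of_mem_erase (hsub he))) rfl
      simpa using add_mem this htm

/-- The image of the transfer consists of the symmetric polynomials which vanish on the diagonal
where `p` variables coincide. -/
theorem mem_transferIdeal_iff (p m : ℕ) [Fact p.Prime] (f : Inv (ZMod p) (m + p)) :
    f ∈ transferIdeal (ZMod p) (m + p) ↔
      rename (collapse m p) (f : MvPolynomial (Fin (m + p)) (ZMod p)) = 0 := by
  constructor
  · rintro ⟨g, rfl⟩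
    exact rename_collapse_transfer p m g
  · intro h
    refine mem_transferIdeal_of_stabilizer _ _ f fun d hd => ?_
    -- The stabilizer is a product of symmetric groups on the fibres of `d`, so `p` divides its
    -- order only if some fibre has at least `p` elements.
    rw [DomMulAct.stabilizer_card', Ne, CharP.cast_eq_zero_iff (ZMod p) p,
      (Fact.out : p.Prime).prime.dvd_finsetProd_iff]
    rintro ⟨k, _, hk⟩
    rw [(Fact.out : p.Prime).dvd_factorial] at hk
    exact absurd (card_fiber_lt_of_rename_collapse p m f.2 h hd k) (not_lt.2 hk)

theorem transferIdeal_eq_top {p n : ℕ} [Fact p.Prime] (h : n < p) :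
    transferIdeal (ZMod p) n = ⊤ := by
  have hn : ((n.factorial : ℕ) : ZMod p) ≠ 0 := by
    rw [Ne, CharP.cast_eq_zero_iff (ZMod p) p, (Fact.out : p.Prime).dvd_factorial]
    omega
  rw [Ideal.eq_top_iff_one]
  refine ⟨C ((n.factorial : ZMod p)⁻¹), Subtype.ext ?_⟩
  rw [transfer_apply]
  simp only [rename_C, Finset.sum_const, Finset.card_univ, Fintype.card_perm, Fintype.card_fin]
  rw [nsmul_eq_mul, ← map_natCast C, ← C_mul, mul_inv_cancel₀ hn, C_1]
  rfl

/-! ### Restriction to the diagonal in elementary symmetric coordinates. -/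

/-- The variable `e_i` of `R[e_1, …, e_n]` for every natural number `i`, with the conventions
`e_0 = 1` and `e_i = 0` for `i > n`. -/
noncomputable def elemVar (R : Type*) [CommRing R] (n : ℕ) : ℕ → MvPolynomial (Fin n) R
  | 0 => 1
  | i + 1 => if h : i < n then X ⟨i, h⟩ else 0

section elemVar

variable {R : Type*} [CommRing R]

@[simp] theorem elemVar_zero (n : ℕ) : elemVar R n 0 = 1 := rfl

theorem elemVar_fin_succ {n : ℕ} (i : Fin n) : elemVar R n (i + 1) = X i := by
  simp [elemVar]

theorem elemVar_eq_zero {n i : ℕ} (h : n < i) : elemVar R n i = 0 := by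
  obtain ⟨i, rfl⟩ : ∃ j, i = j + 1 := ⟨i - 1, by omega⟩
  simp [elemVar, show ¬ i < n by omega]

/-- Families `φ` indexed by `ℕ` with `φ 0 = 1` that vanish beyond `n` are images of `elemVar`. -/
theorem map_elemVar {n : ℕ} {S F : Type*} [CommRing S] [FunLike F (MvPolynomial (Fin n) R) S]
    [RingHomClass F (MvPolynomial (Fin n) R) S] (g : F) (φ : ℕ → S) (h0 : φ 0 = 1)
    (h1 : ∀ i, n < i → φ i = 0) (hg : ∀ i : Fin n, g (X i) = φ (i + 1)) (i : ℕ) :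
    g (elemVar R n i) = φ i := by
  rcases Nat.lt_or_ge n i with h | h
  · rw [elemVar_eq_zero h, map_zero, h1 i h]
  · rcases Nat.eq_zero_or_pos i with rfl | hi
    · simp [h0]
    · have := elemVar_fin_succ (R := R) (⟨i - 1, by omega⟩ : Fin n)
      have h2 := hg ⟨i - 1, by omega⟩
      simp only [Nat.sub_add_cancel hi] at this h2
      rw [this, h2]

/-- The variable `e_{i-p}`, which is `0` for `i < p`. -/
noncomputable def lowVar (R : Type*) [CommRing R] (n p i : ℕ) : MvPolynomial (Fin n) R :=
  if p ≤ i then elemVar R n (i - p) else 0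

theorem lowVar_add (n p i : ℕ) : lowVar R n p (i + p) = elemVar R n i := by
  simp [lowVar]

theorem lowVar_of_lt {n p i : ℕ} (h : i < p) : lowVar R n p i = 0 := by
  simp [lowVar, h]

end elemVar

theorem elemEquiv_elemVar (k : Type*) [CommRing k] (n i : ℕ) :
    (elemEquiv k n (elemVar k n i) : MvPolynomial (Fin n) k) = esymm (Fin n) k i := by
  refine map_elemVar ((Inv k n).val.comp (elemEquiv k n).toAlgHom) (esymm (Fin n) k)
    (esymm_zero _ _) (fun i hi => ?_) (fun i => elemEquiv_X k n i) i
  rw [esymm, Finset.powersetCard_eq_empty.2 (by simpa using hi), Finset.sum_empty]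

/-- Identifying the last `p` variables with `y` sends `e_i` to `e_i + y ^ p * e_{i-p}` in
characteristic `p`. -/
theorem rename_collapse_esymm (p m : ℕ) [Fact p.Prime] (i : ℕ) :
    rename (collapse m p) (esymm (Fin (m + p)) (ZMod p) i) =
      rename some (esymm (Fin m) (ZMod p) i) +
        X none ^ p * (if p ≤ i then rename some (esymm (Fin m) (ZMod p) (i - p)) else 0) := by
  have hvan : ∀ n j, n < j → esymm (Fin n) (ZMod p) j = 0 := by
    intro n j hj
    rw [esymm, Finset.powersetCard_eq_empty.2 (by simpa using hj), Finset.sum_empty]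
  have hren : ∀ (n j : ℕ) (θ : Fin n → Option (Fin m)), rename θ (esymm (Fin n) (ZMod p) j) =
      (Finset.univ.val.map fun x => (X (θ x) : MvPolynomial (Option (Fin m)) (ZMod p))).esymm j := by
    intro n j θ
    rw [← aeval_esymm_eq_multiset_esymm (Fin n) (ZMod p)]
    exact AlgHom.congr_fun (MvPolynomial.algHom_ext (fun i => by simp)) _
  have hco : ∀ (n j : ℕ) (θ : Fin n → Option (Fin m)), j ≤ n →
      (∏ x : Fin n, (Polynomial.X + Polynomial.C
        (X (θ x) : MvPolynomial (Option (Fin m)) (ZMod p)))).coeff j =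
      rename θ (esymm (Fin n) (ZMod p) (n - j)) := by
    intro n j θ hj
    rw [hren, Finset.prod, Multiset.prod_X_add_C_coeff' _ _ (by simpa using hj)]
    simp
  set P := ∏ x : Fin m, (Polynomial.X + Polynomial.C
    (X (some x) : MvPolynomial (Option (Fin m)) (ZMod p))) with hP
  have hPdeg : ∀ j, m < j → P.coeff j = 0 := by
    intro j hj
    refine Polynomial.coeff_eq_zero_of_natDegree_lt (lt_of_le_of_lt ?_ hj)
    refine (Polynomial.natDegree_prod_le _ _).trans ?_
    simp
  have hprod : ∏ x : Fin (m + p), (Polynomial.X + Polynomial.C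
      (X (collapse m p x) : MvPolynomial (Option (Fin m)) (ZMod p))) =
      P * Polynomial.X ^ p + Polynomial.C (X none ^ p) * P := by
    rw [Fin.prod_univ_add]
    simp only [collapse_castAdd, collapse_natAdd, Finset.prod_const, Finset.card_univ,
      Fintype.card_fin]
    -- The last `p` factors are equal, and their product is `T ^ p + y ^ p` by Frobenius.
    rw [add_pow_char, ← hP, map_pow]
    ring
  rcases Nat.lt_or_ge (m + p) i with hi | hi
  · rw [hvan _ _ hi, hvan m i (by omega), if_pos (by omega), hvan m (i - p) (by omega)]
    simp
  · have h1 := hco (m + p) (m + p - i) (collapse m p) (by omega)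
    rw [show m + p - (m + p - i) = i by omega, hprod, Polynomial.coeff_add,
      Polynomial.coeff_C_mul, Polynomial.coeff_mul_X_pow'] at h1
    rw [← h1]
    congr 1
    · split_ifs with h
      · rw [hco m _ some (by omega)]
        congr 2
        omega
      · rw [hvan m i (by omega), map_zero]
    · congr 1
      split_ifs with h
      · rw [hco m _ some (by omega)]
        congr 2
        omega
      · exact hPdeg _ (by omega)

theorem optionEquivLeft_symm_C (k : Type*) [CommRing k] (m : ℕ) (f : MvPolynomial (Fin m) k) :
    (optionEquivLeft k (Fin m)).symm (Polynomial.C f) = rename some f := by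
  rw [AlgEquiv.symm_apply_eq]
  have : ((optionEquivLeft k (Fin m)).toAlgHom.comp (rename some)).toRingHom = Polynomial.C := by
    ext i : 2 <;> simp
  exact (RingHom.congr_fun this f).symm

/-- Restriction to the diagonal in terms of elementary symmetric polynomials; the polynomial
variable stands for the `p`-th power of the common value of the identified variables. -/
noncomputable def diagHom (p m n : ℕ) :
    MvPolynomial (Fin n) (ZMod p) →ₐ[ZMod p] Polynomial (MvPolynomial (Fin m) (ZMod p)) :=
  aeval fun i => Polynomial.C (elemVar (ZMod p) m (i + 1)) +
    Polynomial.X * Polynomial.C (lowVar (ZMod p) m p (i + 1))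

theorem diagHom_elemVar (p : ℕ) [Fact p.Prime] {m n : ℕ} (h : n = m + p) (i : ℕ) :
    diagHom p m n (elemVar (ZMod p) n i) = Polynomial.C (elemVar (ZMod p) m i) +
      Polynomial.X * Polynomial.C (lowVar (ZMod p) m p i) := by
  refine map_elemVar (diagHom p m n) (fun i => Polynomial.C (elemVar (ZMod p) m i) +
      Polynomial.X * Polynomial.C (lowVar (ZMod p) m p i)) ?_ (fun i hi => ?_) (fun i => ?_) i
  · simp [lowVar_of_lt (Fact.out : p.Prime).pos]
  · simp only [elemVar_eq_zero (show m < i by omega), lowVar, if_pos (show p ≤ i by omega),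
      elemVar_eq_zero (show m < i - p by omega)]
    simp
  · simp [diagHom]

theorem elemEquiv_mem_transferIdeal_iff (p : ℕ) [Fact p.Prime] {m n : ℕ} (h : n = m + p)
    (a : MvPolynomial (Fin n) (ZMod p)) :
    elemEquiv (ZMod p) n a ∈ transferIdeal (ZMod p) n ↔ diagHom p m n a = 0 := by
  subst h
  let E : MvPolynomial (Fin m) (ZMod p) →+* MvPolynomial (Fin m) (ZMod p) :=
    ((Inv (ZMod p) m).val.comp (elemEquiv (ZMod p) m).toAlgHom).toRingHom
  have hE : ∀ i, E (elemVar (ZMod p) m i) = esymm (Fin m) (ZMod p) i := fun i =>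
    elemEquiv_elemVar (ZMod p) m i
  have hEinj : Function.Injective E :=
    Subtype.val_injective.comp (elemEquiv (ZMod p) m).injective
  -- The ring of abstract `e_i` and `t` embeds in the polynomials in `x` and `y` by evaluating the
  -- `e_i` and setting `t = y ^ p`. Injectivity of `κ` lets vanishing be tested before this
  -- substitution.
  let κ : Polynomial (MvPolynomial (Fin m) (ZMod p)) →+* MvPolynomial (Option (Fin m)) (ZMod p) :=
    ((optionEquivLeft (ZMod p) (Fin m)).symm.toRingEquiv.toRingHom.comp
      (Polynomial.expand _ p).toRingHom).comp (Polynomial.mapRingHom E)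
  have hκinj : Function.Injective κ :=
    ((optionEquivLeft (ZMod p) (Fin m)).symm.injective.comp
      (Polynomial.expand_injective (Fact.out : p.Prime).pos)).comp
      (Polynomial.map_injective E hEinj)
  have hκC : ∀ b, κ (Polynomial.C b) = rename some (E b) := by
    intro b
    simp [κ, optionEquivLeft_symm_C]
  have hκX : κ Polynomial.X = X none ^ p := by
    simp [κ]
  have hcomp : ((rename (collapse m p)).comp ((Inv (ZMod p) (m + p)).val.comp
      (elemEquiv (ZMod p) (m + p)).toAlgHom)).toRingHom =
      κ.comp (diagHom p m (m + p)).toRingHom := by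
    refine MvPolynomial.ringHom_ext' (RingHom.ext_zmod _ _) fun i => ?_
    have h1 : (elemEquiv (ZMod p) (m + p) (X i) : MvPolynomial (Fin (m + p)) (ZMod p)) = _ :=
      elemEquiv_X (ZMod p) (m + p) i
    change rename (collapse m p) (elemEquiv (ZMod p) (m + p) (X i)).1 = κ (diagHom p m (m + p) (X i))
    rw [h1, rename_collapse_esymm, ← elemVar_fin_succ i, diagHom_elemVar p rfl, map_add, map_mul,
      hκC, hκC, hκX, hE]
    congr 2
    rw [lowVar]
    split_ifs
    · rw [hE]
    · simp
  rw [mem_transferIdeal_iff]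
  have := RingHom.congr_fun hcomp a
  change rename (collapse m p) (elemEquiv (ZMod p) (m + p) a).1 = κ (diagHom p m (m + p) a) at this
  rw [this, map_eq_zero_iff κ hκinj]

/-! ### The invariant ring as a polynomial ring over `A`. -/

/-- The image of `e'_i` in `𝔽_p[e_1, …, e_{qp+r}]`. -/
noncomputable def embedVar (p q r i : ℕ) : MvPolynomial (Fin (q * p + r)) (ZMod p) :=
  -- With `b = i % p`, this is a coefficient of `(E_b - e_b E_0) / T`; dividing by `T` shifts the
  -- index by `p`.
  if 1 ≤ i % p ∧ i % p ≤ r then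
    elemVar (ZMod p) (q * p + r) (i + p) -
      elemVar (ZMod p) (q * p + r) (i % p) * elemVar (ZMod p) (q * p + r) (i + p - i % p)
  else elemVar (ZMod p) (q * p + r) i

/-- The embedding of `𝔽_p[e'_1, …, e'_{qp}]` into `𝔽_p[e_1, …, e_{qp+r}]`. -/
noncomputable def embed (p q r : ℕ) :
    A p q →ₐ[ZMod p] MvPolynomial (Fin (q * p + r)) (ZMod p) :=
  aeval fun i => embedVar p q r (i + 1)

/-- The image of `e_i` under the identification of `𝔽_p[e_1, …, e_{qp+r}]` with a polynomial ring
over `𝔽_p[e'_1, …, e'_{qp}]`. -/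
noncomputable def splitVar (p q r i : ℕ) : MvPolynomial (Fin r) (A p q) :=
  -- This solves `e'_{i-p} = e_i - e_b * e_{i-b}` for `e_i`, with `e_{i-b} = e'_{i-b}` as `p`
  -- divides `i - b`. For `i < p` only `e_b * e'_0 = e_b` remains.
  if 1 ≤ i % p ∧ i % p ≤ r then
    C (lowVar (ZMod p) (q * p) p i) +
      elemVar (A p q) r (i % p) * C (elemVar (ZMod p) (q * p) (i - i % p))
  else C (elemVar (ZMod p) (q * p) i)

/-- The inverse of `assemble`. -/
noncomputable def split (p q r : ℕ) :
    MvPolynomial (Fin (q * p + r)) (ZMod p) →ₐ[ZMod p] MvPolynomial (Fin r) (A p q) :=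
  aeval fun i => splitVar p q r (i + 1)

/-- The extension of `embed` to a polynomial ring in `r` variables, which go to
`e_1, …, e_r`. -/
noncomputable def assemble (p q r : ℕ) :
    MvPolynomial (Fin r) (A p q) →ₐ[ZMod p] MvPolynomial (Fin (q * p + r)) (ZMod p) :=
  aevalTower (embed p q r) fun b => elemVar (ZMod p) (q * p + r) (b + 1)

theorem assemble_C {p q r : ℕ} (a : A p q) : assemble p q r (C a) = embed p q r a := by
  simp [assemble]

theorem assemble_elemVar {p q r b : ℕ} (hb : b ≤ r) :
    assemble p q r (elemVar (A p q) r b) = elemVar (ZMod p) (q * p + r) b := by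
  rcases Nat.eq_zero_or_pos b with rfl | h
  · simp
  · have := elemVar_fin_succ (R := A p q) (⟨b - 1, by omega⟩ : Fin r)
    simp only [Nat.sub_add_cancel h] at this
    rw [this, assemble, aevalTower_X]
    simp only [Nat.sub_add_cancel h]

theorem sub_mod_mod_eq_zero (i p : ℕ) : (i - i % p) % p = 0 :=
  Nat.sub_mod_eq_zero_of_mod_eq (by simp)

variable {p q r : ℕ} [Fact p.Prime]

/-- The indices from `qp + 1` to `qp + r` have exactly the residues `1, …, r`. This makes the
defining formula of `embedVar` vanish beyond `qp`, as `map_elemVar` requires. -/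
theorem lt_of_mul_lt {i : ℕ} (h : q * p < i) (hi : ¬ (1 ≤ i % p ∧ i % p ≤ r)) (hr : r < p) :
    q * p + r < i := by
  have h1 := Nat.div_add_mod' i p
  have hp := (Fact.out : p.Prime).pos
  have hm := Nat.mod_lt i hp
  have h2 : q ≤ i / p := (Nat.le_div_iff_mul_le hp).2 h.le
  have h3 : q * p ≤ i / p * p := Nat.mul_le_mul_right p h2
  rcases Nat.eq_zero_or_pos (i % p) with h0 | h0
  · have h4 : q < i / p := by
      refine lt_of_le_of_ne h2 fun h5 => ?_
      rw [← h5] at h1; omega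
    have h5 : (q + 1) * p ≤ i / p * p := Nat.mul_le_mul_right p h4
    rw [add_mul] at h5
    omega
  · omega

theorem embed_elemVar (hr : r < p) (i : ℕ) :
    embed p q r (elemVar (ZMod p) (q * p) i) = embedVar p q r i := by
  refine map_elemVar (embed p q r) (embedVar p q r) (by simp [embedVar]) (fun i hi => ?_)
    (fun i => by simp [embed]) i
  rw [embedVar]
  have hm := Nat.mod_lt i (Fact.out : p.Prime).pos
  split_ifs with h
  · rw [elemVar_eq_zero (show q * p + r < i + p by omega)]
    have h2 : q * p + r < i + p - i % p := by
      refine lt_of_mul_lt (p := p) (by omega) ?_ hr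
      have : i + p - i % p = p * (i / p + 1) := by
        have := Nat.div_add_mod i p
        rw [mul_add]; omega
      rw [this]; simp
    rw [elemVar_eq_zero h2]
    simp
  · exact elemVar_eq_zero (lt_of_mul_lt hi h hr)

theorem split_elemVar (hr : r < p) (i : ℕ) :
    split p q r (elemVar (ZMod p) (q * p + r) i) = splitVar p q r i := by
  refine map_elemVar (split p q r) (splitVar p q r) (by simp [splitVar]) (fun i hi => ?_)
    (fun i => by simp [split]) i
  rw [splitVar]
  have hm := Nat.mod_lt i (Fact.out : p.Prime).pos
  split_ifs with h
  -- An index beyond `qp + r` with residue at most `r` lies in a later block of length `p`, so both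
  -- coefficients from `A` vanish.
  · have h1 : q * p + p ≤ i - i % p := by
      have h1 := Nat.div_add_mod' i p
      have h2 : q < i / p := by
        by_contra! h2
        have := Nat.mul_le_mul_right p h2
        omega
      have : (q + 1) * p ≤ i / p * p := Nat.mul_le_mul_right p h2
      rw [add_mul] at this
      omega
    rw [elemVar_eq_zero (show q * p < i - i % p by omega), lowVar,
      elemVar_eq_zero (show q * p < i - p by omega)]
    simp
  · rw [elemVar_eq_zero (by omega), map_zero]

theorem split_embedVar (hr : r < p) (i : ℕ) :
    split p q r (embedVar p q r i) = C (elemVar (ZMod p) (q * p) i) := by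
  have hp := (Fact.out : p.Prime).pos
  have hm := Nat.mod_lt i hp
  rw [embedVar]
  split_ifs with h
  · rw [map_sub, map_mul, split_elemVar hr, split_elemVar hr, split_elemVar hr, splitVar, splitVar,
      splitVar]
    have h1 : (i + p - i % p) % p = 0 := by
      have := sub_mod_mod_eq_zero (i + p) p
      rwa [Nat.add_mod_right] at this
    rw [Nat.add_mod_right, Nat.mod_mod, h1, if_pos h, if_pos h, if_neg (by omega), lowVar_add,
      lowVar_of_lt hm, Nat.sub_self, elemVar_zero, map_zero, map_one]
    ring
  · rw [split_elemVar hr, splitVar, if_neg h]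

theorem assemble_splitVar (hr : r < p) (i : ℕ) :
    assemble p q r (splitVar p q r i) = elemVar (ZMod p) (q * p + r) i := by
  have hp := (Fact.out : p.Prime).pos
  have hm := Nat.mod_lt i hp
  rw [splitVar]
  split_ifs with h
  · rw [map_add, map_mul, assemble_C, assemble_C, assemble_elemVar h.2, embed_elemVar hr]
    rw [show embedVar p q r (i - i % p) = elemVar (ZMod p) (q * p + r) (i - i % p) by
      rw [embedVar, if_neg (by rw [sub_mod_mod_eq_zero]; omega)]]
    rcases Nat.lt_or_ge i p with hi | hi
    · rw [lowVar_of_lt hi, Nat.mod_eq_of_lt hi]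
      simp
    · obtain ⟨j, rfl⟩ : ∃ j, i = j + p := ⟨i - p, by omega⟩
      rw [lowVar_add, embed_elemVar hr]
      rw [Nat.add_mod_right] at h ⊢
      rw [embedVar, if_pos h]
      ring
  · rw [assemble_C, embed_elemVar hr, embedVar, if_neg h]

/-- `𝔽_p[e_1, …, e_{qp+r}]` is a polynomial ring in `r` variables over `𝔽_p[e'_1, …, e'_{qp}]`. -/
noncomputable def assembleEquiv (q : ℕ) (hr : r < p) :
    MvPolynomial (Fin r) (A p q) ≃ₐ[ZMod p] MvPolynomial (Fin (q * p + r)) (ZMod p) :=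
  AlgEquiv.ofAlgHom (assemble p q r) (split p q r)
    (by
      ext i : 1
      have := assemble_splitVar (q := q) hr (i + 1)
      simpa [split] using this.trans (elemVar_fin_succ i))
    (by
      refine AlgHom.coe_ringHom_injective
        (MvPolynomial.ringHom_ext' (MvPolynomial.ringHom_ext' (RingHom.ext_zmod _ _) fun i => ?_)
          fun b => ?_)
      · change split p q r (assemble p q r (C (X i))) = C (X i)
        rw [assemble_C, ← elemVar_fin_succ i, embed_elemVar hr, split_embedVar hr]
      · change split p q r (assemble p q r (X b)) = X b
        have hb : ((b : ℕ) + 1) % p = b + 1 := Nat.mod_eq_of_lt (by omega)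
        rw [← elemVar_fin_succ b, assemble_elemVar (by omega), split_elemVar hr, splitVar, hb,
          if_pos (by omega), lowVar_of_lt (by omega)]
        simp)

/-! ### Compatibility of the splitting with restriction to the diagonal. -/

/-- The analogue of `assemble` after adjoining the diagonal parameter. -/
noncomputable def assembleDiag (q : ℕ) (hr : r < p) :
    MvPolynomial (Fin r) (Polynomial (A p q)) →+*
      Polynomial (MvPolynomial (Fin (q * p + r)) (ZMod p)) :=
  -- The two `optionEquiv` maps exchange the order of adjoining `t` and `e_1, …, e_r`.
  (Polynomial.mapRingHom (assembleEquiv q hr).toRingEquiv.toRingHom).comp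
    (((optionEquivRight (A p q) (Fin r)).symm.trans
      (optionEquivLeft (A p q) (Fin r))).toRingEquiv.toRingHom)

theorem assembleDiag_injective (q : ℕ) (hr : r < p) : Function.Injective (assembleDiag q hr) :=
  (Polynomial.map_injective _ (assembleEquiv q hr).injective).comp
    ((optionEquivRight (A p q) (Fin r)).symm.trans (optionEquivLeft (A p q) (Fin r))).injective

theorem assembleDiag_C_C (hr : r < p) (a : A p q) :
    assembleDiag q hr (C (Polynomial.C a)) = Polynomial.C (embed p q r a) := by
  have h : (optionEquivRight (A p q) (Fin r)).symm (C (Polynomial.C a)) = C a := by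
    rw [AlgEquiv.symm_apply_eq, optionEquivRight_C]
  simp [assembleDiag, h, optionEquivLeft_C, assembleEquiv, assemble_C]

theorem assembleDiag_C_X (hr : r < p) :
    assembleDiag q hr (C Polynomial.X) = Polynomial.X := by
  have h : (optionEquivRight (A p q) (Fin r)).symm (C Polynomial.X) = X none := by
    rw [AlgEquiv.symm_apply_eq, optionEquivRight_X_none]
  simp [assembleDiag, h, optionEquivLeft_X_none]

theorem assembleDiag_X (hr : r < p) (b : Fin r) :
    assembleDiag q hr (X b) = Polynomial.C (elemVar (ZMod p) (q * p + r) (b + 1)) := by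
  have h : (optionEquivRight (A p q) (Fin r)).symm (X b) = X (some b) := by
    rw [AlgEquiv.symm_apply_eq, optionEquivRight_X_some]
  simp [assembleDiag, h, optionEquivLeft_X_some, assembleEquiv, assemble]

/-- Both `E_b` and `(E_b - e_b E_0) / T` are multiplied by `1 + t T`, and `e_1, …, e_r` are fixed
because `r < p`. Identifying `p` variables lowers `q + 1` to `q`. -/
theorem diagHom_assemble (q : ℕ) (hr : r < p) (x : MvPolynomial (Fin r) (A p (q + 1))) :
    diagHom p (q * p + r) ((q + 1) * p + r) (assemble p (q + 1) r x) =
      assembleDiag q hr (MvPolynomial.map (diagHom p (q * p) ((q + 1) * p)).toRingHom x) := by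
  have hp := (Fact.out : p.Prime).pos
  have hn : (q + 1) * p + r = q * p + r + p := by ring
  have hn' : (q + 1) * p = q * p + p := by ring
  suffices h : (diagHom p (q * p + r) ((q + 1) * p + r)).toRingHom.comp
      (assemble p (q + 1) r).toRingHom = (assembleDiag q hr).comp
        (MvPolynomial.map (diagHom p (q * p) ((q + 1) * p)).toRingHom) from RingHom.congr_fun h x
  refine MvPolynomial.ringHom_ext' (MvPolynomial.ringHom_ext' (RingHom.ext_zmod _ _) fun i => ?_)
    fun b => ?_
  · change diagHom p (q * p + r) ((q + 1) * p + r) (assemble p (q + 1) r (C (X i))) =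
      assembleDiag q hr (MvPolynomial.map (diagHom p (q * p) ((q + 1) * p)).toRingHom (C (X i)))
    rw [map_C, ← elemVar_fin_succ i, assemble_C, embed_elemVar hr]
    change _ = assembleDiag q hr (C (diagHom p (q * p) ((q + 1) * p) _))
    generalize (i : ℕ) + 1 = j
    have hm := Nat.mod_lt j hp
    rw [diagHom_elemVar p hn', map_add, map_mul, map_add, map_mul, assembleDiag_C_C,
      assembleDiag_C_C, assembleDiag_C_X, embed_elemVar hr, embedVar, embedVar]
    split_ifs with h
    · have h1 : lowVar (ZMod p) (q * p + r) p (j + p - j % p) =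
          elemVar (ZMod p) (q * p + r) (j - j % p) := by
        rw [show j + p - j % p = j - j % p + p by have := Nat.mod_le j p; omega, lowVar_add]
      simp only [map_sub, map_mul, diagHom_elemVar p hn, lowVar_add, lowVar_of_lt hm, map_zero, h1,
        mul_zero, add_zero]
      -- For `j < p` the terms `t * e_j` coming from `e_{j+p}` and from `e_j * e_p` cancel, in
      -- agreement with `e'_j` being fixed.
      rcases Nat.lt_or_ge j p with hj | hj
      · rw [lowVar_of_lt hj, Nat.mod_eq_of_lt hj]
        simp
        ring
      · obtain ⟨l, rfl⟩ : ∃ l, j = l + p := ⟨j - p, by omega⟩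
        rw [Nat.add_mod_right] at h ⊢
        rw [lowVar_add, embed_elemVar hr, embedVar, if_pos h, map_sub, map_mul]
        ring
    · rw [diagHom_elemVar p hn]
      congr 3
      rcases Nat.lt_or_ge j p with hj | hj
      · rw [lowVar_of_lt hj, lowVar_of_lt hj, map_zero]
      · obtain ⟨l, rfl⟩ : ∃ l, j = l + p := ⟨j - p, by omega⟩
        rw [Nat.add_mod_right] at h
        rw [lowVar_add, lowVar_add, embed_elemVar hr, embedVar, if_neg h]
  · change diagHom p (q * p + r) ((q + 1) * p + r) (assemble p (q + 1) r (X b)) =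
      assembleDiag q hr (MvPolynomial.map (diagHom p (q * p) ((q + 1) * p)).toRingHom (X b))
    rw [map_X, assembleDiag_X, ← elemVar_fin_succ b, assemble_elemVar (by omega),
      diagHom_elemVar p hn, lowVar_of_lt (by omega)]
    simp

/-! ### Flatness of `ι_r` and the ideal generated by `I_{qp}`. -/

/-- The homomorphism `ι_r`. -/
noncomputable def iota (p q r : ℕ) : A p q →+* Inv (ZMod p) (q * p + r) :=
  (elemEquiv (ZMod p) (q * p + r)).toRingEquiv.toRingHom.comp (embed p q r).toRingHom

/-- The presentation of `R^{S_{qp+r}}` as a polynomial ring over `A`. -/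
noncomputable def invEquiv (q : ℕ) (hr : r < p) :
    MvPolynomial (Fin r) (A p q) ≃+* Inv (ZMod p) (q * p + r) :=
  ((assembleEquiv q hr).trans (elemEquiv (ZMod p) (q * p + r))).toRingEquiv

theorem iota_eq (q : ℕ) (hr : r < p) : iota p q r = (invEquiv q hr).toRingHom.comp C := by
  refine RingHom.ext fun a => ?_
  exact congrArg (elemEquiv (ZMod p) (q * p + r)) (assemble_C a).symm

theorem iota_injective (q : ℕ) (hr : r < p) : Function.Injective (iota p q r) := by
  rw [iota_eq q hr]
  exact (invEquiv q hr).injective.comp (C_injective _ _)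

theorem iota_flat (q : ℕ) (hr : r < p) : (iota p q r).Flat := by
  rw [iota_eq q hr]
  refine RingHom.Flat.comp ?_ (RingHom.Flat.of_bijective (invEquiv q hr).bijective)
  rw [← algebraMap_eq, RingHom.flat_algebraMap_iff]
  infer_instance

theorem map_iota_baseIdeal (q : ℕ) (hr : r < p) :
    (baseIdeal p q).map (iota p q r) = transferIdeal (ZMod p) (q * p + r) := by
  have hp := (Fact.out : p.Prime).pos
  -- For `q = 0` there are not `p` variables to identify, but then both transfer ideals are the unit
  -- ideal.
  cases q with
  | zero =>
    rw [transferIdeal_eq_top (show 0 * p + r < p by omega), baseIdeal,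
      transferIdeal_eq_top (show 0 * p < p by omega), Ideal.comap_top, Ideal.map_top]
  | succ q =>
    have hbase : baseIdeal p (q + 1) =
        RingHom.ker (diagHom p (q * p) ((q + 1) * p)).toRingHom := by
      ext a
      exact elemEquiv_mem_transferIdeal_iff p (by ring) a
    have hcomap : (transferIdeal (ZMod p) ((q + 1) * p + r)).comap (invEquiv (q + 1) hr).toRingHom =
        (baseIdeal p (q + 1)).map C := by
      -- The kernel of a coefficientwise map of polynomial rings is generated by the kernel on
      -- coefficients.
      rw [hbase, ← MvPolynomial.ker_map]
      ext x
      refine (elemEquiv_mem_transferIdeal_iff p (m := q * p + r) (by ring)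
        (assemble p (q + 1) r x)).trans ?_
      rw [diagHom_assemble q hr, map_eq_zero_iff _ (assembleDiag_injective q hr)]
      rfl
    rw [iota_eq (q + 1) hr, ← Ideal.map_map, ← hcomap]
    exact Ideal.map_comap_of_surjective (invEquiv (q + 1) hr).toRingHom
      (invEquiv (q + 1) hr).surjective _

/-! ### The grading by residues modulo `p`. -/

/-- Weighted homogeneity is preserved by a substitution that preserves the weights of variables. -/
theorem isWeightedHomogeneous_aeval {R σ τ M : Type*} [CommRing R] [AddCommMonoid M] {w : σ → M}
    {w' : τ → M} (f : σ → MvPolynomial τ R) (hf : ∀ i, (f i).IsWeightedHomogeneous w' (w i))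
    {d : M} {a : MvPolynomial σ R} (ha : a.IsWeightedHomogeneous w d) :
    (aeval f a).IsWeightedHomogeneous w' d := by
  induction ha using IsWeightedHomogeneous.induction_on with
  | zero => rw [map_zero]; exact isWeightedHomogeneous_zero _ _ _
  | add a b _ _ iha ihb => rw [map_add]; exact iha.add ihb
  | monomial e c he =>
    rw [aeval_monomial, algebraMap_eq, ← he, Finsupp.weight_apply]
    exact (IsWeightedHomogeneous.prod _ _ _ fun i _ => (hf i).pow (e i)).C_mul c

theorem mem_polyDegree {p m : ℕ} {d : ZMod p} {a : MvPolynomial (Fin m) (ZMod p)} :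
    a ∈ polyDegree p m d ↔
      a.IsWeightedHomogeneous (fun i : Fin m => ((i + 1 : ℕ) : ZMod p)) d := Iff.rfl

theorem elemVar_mem_polyDegree (p n i : ℕ) : elemVar (ZMod p) n i ∈ polyDegree p n i := by
  cases i with
  | zero =>
    rw [mem_polyDegree, Nat.cast_zero]
    exact isWeightedHomogeneous_one (ZMod p) _
  | succ i =>
    rw [elemVar]
    split_ifs with h
    · exact isWeightedHomogeneous_X (ZMod p) _ (⟨i, h⟩ : Fin n)
    · exact zero_mem _

/-- Both terms have weight `i + p`, which equals `i` only modulo `p`; hence a grading by `ZMod p`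
and not by `ℕ`. -/
theorem embedVar_mem_polyDegree (p q r i : ℕ) : embedVar p q r i ∈ polyDegree p (q * p + r) i := by
  rw [embedVar]
  split_ifs with h
  · refine sub_mem ?_ ?_
    · simpa using elemVar_mem_polyDegree p (q * p + r) (i + p)
    · have h1 := IsWeightedHomogeneous.mul (elemVar_mem_polyDegree p (q * p + r) (i % p))
        (elemVar_mem_polyDegree p (q * p + r) (i + p - i % p))
      rw [← Nat.cast_add, show i % p + (i + p - i % p) = i + p by
        have := Nat.mod_le i p; omega, Nat.cast_add i p,
        ZMod.natCast_self, add_zero] at h1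
      exact h1
  · exact elemVar_mem_polyDegree p _ i

theorem iota_mem_invDegree (p q r : ℕ) (d : ZMod p) (a : A p q) (ha : a ∈ polyDegree p (q * p) d) :
    iota p q r a ∈ invDegree p (q * p + r) d :=
  ⟨embed p q r a, isWeightedHomogeneous_aeval _
    (fun i : Fin (q * p) => embedVar_mem_polyDegree p q r (i + 1))
    (mem_polyDegree.1 ha), rfl⟩

/-! ### Flat base change of ideals and the conclusion. -/

/-- For a flat homomorphism `ι`, the rule `s ⊗ a ↦ s * ι a` identifies `B ⊗ I` with the ideal
generated by `ι I`. -/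
theorem tensorIso_map {A B : Type*} [CommRing A] [CommRing B] (ι : A →+* B) (h : ι.Flat)
    (I : Ideal A) : TensorIso ι I (I.map ι) := by
  let _ : Algebra A B := ι.toAlgebra
  have : Module.Flat A B := h
  let φ : (B ⊗[A] I) →ₗ[B] B :=
    (Algebra.TensorProduct.rid A B B).toLinearMap ∘ₗ
      LinearMap.baseChange B (Submodule.subtype I)
  have hφ : ∀ (s : B) (a : I), φ (s ⊗ₜ[A] a) = s * ι (a : A) := by
    intro s a
    simp [φ, Algebra.smul_def, mul_comm, RingHom.algebraMap_toAlgebra]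
  have hinj : Function.Injective φ :=
    (Algebra.TensorProduct.rid A B B).injective.comp
      (Module.Flat.lTensor_preserves_injective_linearMap _ I.injective_subtype)
  have hrange : LinearMap.range φ = I.map ι := by
    apply le_antisymm
    · rintro _ ⟨x, rfl⟩
      induction x using TensorProduct.induction_on with
      | zero => rw [map_zero]; exact zero_mem _
      | tmul s a => rw [hφ]; exact Ideal.mul_mem_left _ _ (Ideal.mem_map_of_mem ι a.2)
      | add x y hx hy => rw [map_add]; exact add_mem hx hy
    · rw [Ideal.map_le_iff_le_comap]
      intro a ha
      exact ⟨1 ⊗ₜ[A] ⟨a, ha⟩, by rw [hφ, one_mul]⟩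
  exact ⟨(LinearEquiv.ofInjective φ hinj).trans (LinearEquiv.ofEq _ _ hrange), hφ⟩

end SymTransfer

theorem mainTheorem2 (p : ℕ) [Fact p.Prime] (q : ℕ) :
    ∀ r : ℕ, r < p →
      ∃ ι : SymTransfer.A p q →+* SymTransfer.Inv (ZMod p) (q * p + r),
        Function.Injective ι ∧
        (∀ (d : ZMod p) (a : SymTransfer.A p q), a ∈ SymTransfer.polyDegree p (q * p) d →
          ι a ∈ SymTransfer.invDegree p (q * p + r) d) ∧
        ι.Flat ∧
        SymTransfer.TensorIso ι (SymTransfer.baseIdeal p q)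
          (SymTransfer.transferIdeal (ZMod p) (q * p + r)) := by
  intro r hr
  refine ⟨SymTransfer.iota p q r, SymTransfer.iota_injective q hr,
    SymTransfer.iota_mem_invDegree p q r, SymTransfer.iota_flat q hr, ?_⟩
  rw [← SymTransfer.map_iota_baseIdeal q hr]
  exact SymTransfer.tensorIso_map _ (SymTransfer.iota_flat q hr) _
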